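/- Let $G$ be an abelian group generated by a finite set $S$, and let $d_S(x,y)=|x^{-1}y|_S$ be the word metric, where $|g|_S$ is the least length of a word in the letters $S\cup S^{-1}$ representing $g$. Let $C(G)$ be the space of continuous real functions on $(G,d_S)$ with the topology of uniform convergence on compact sets, let $C^0(G)$ be its quotient by the constant functions, with the quotient topology, and let $C^r(G)=C(G)/C_b(G)$ be its quotient by the subspace $C_b(G)$ of bounded continuous functions. Let the horoboundary $\partial(G,S)\subset C^0(G)$ be the closure of $\{[d_S(x,\cdot)] : x\in G\}$ minus this set itself, and let the reduced horoboundary $\partial^r(G,S)\subset C^r(G)$ be the image of $\partial(G,S)$ under the natural map $C^0(G)\to C^r(G)$. The group $G$ acts on $C^r(G)$ by $g[\phi]=[\phi(g^{-1}\,\cdot)]$. Then $\partial^r(G,S)$ is a finite set, and $G$ acts trivially on it: $g\xi=\xi$ for all $g\in G$ and $\xi\in\partial^r(G,S)$. -/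

import Mathlib

noncomputable section

/-! ### Horoboundary and reduced horoboundary of a metric space

`C(X, ℝ)` carries Mathlib's compact-open topology, that is, uniform convergence on compact sets;
quotients by submodules carry the quotient topology. -/

namespace Horo

section MetricSpaces

variable (X : Type*) [MetricSpace X]

/-- The line of constant functions in `C(X)`. -/
def constants : Submodule ℝ C(X, ℝ) where
  carrier := {f | ∃ c : ℝ, f = ContinuousMap.const X c}
  zero_mem' := ⟨0, rfl⟩
  add_mem' := by
    rintro _ _ ⟨a, rfl⟩ ⟨b, rfl⟩
    exact ⟨a + b, rfl⟩
  smul_mem' := by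
    rintro r _ ⟨a, rfl⟩
    exact ⟨r * a, rfl⟩

/-- The subspace `C_b(X)` of bounded functions in `C(X)`. -/
def bounded : Submodule ℝ C(X, ℝ) where
  carrier := {f | ∃ C : ℝ, ∀ x, |f x| ≤ C}
  zero_mem' := ⟨0, fun x => by simp⟩
  add_mem' := by
    rintro f g ⟨a, ha⟩ ⟨b, hb⟩
    exact ⟨a + b, fun x => (abs_add_le (f x) (g x)).trans (add_le_add (ha x) (hb x))⟩
  smul_mem' := by
    rintro r f ⟨a, ha⟩
    refine ⟨|r| * a, fun x => ?_⟩
    simpa [abs_mul] using mul_le_mul_of_nonneg_left (ha x) (abs_nonneg r)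

theorem constants_le_bounded : constants X ≤ bounded X := by
  rintro _ ⟨c, rfl⟩
  exact ⟨|c|, fun _ => le_rfl⟩

/-- `C⁰(X) = C(X) / constants`. -/
abbrev CZero : Type _ := C(X, ℝ) ⧸ constants X

/-- `Cʳ(X) = C(X) / C_b(X)`. -/
abbrev CRed : Type _ := C(X, ℝ) ⧸ bounded X

/-- The natural map `C⁰(X) → Cʳ(X)`. -/
def toCRed : CZero X →ₗ[ℝ] CRed X := Submodule.factor (constants_le_bounded X)

/-- The function `d(x, ·)`. -/
def distFun (x : X) : C(X, ℝ) := ⟨fun y => dist x y, continuous_const.dist continuous_id⟩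

/-- The natural map `X → C⁰(X)`, `x ↦ [d(x, ·)]`. -/
def embed (x : X) : CZero X := (constants X).mkQ (distFun X x)

/-- The horoboundary: the closure of the image of `X` in `C⁰(X)`, minus that image. -/
def horoboundary : Set (CZero X) := closure (Set.range (embed X)) \ Set.range (embed X)

/-- The reduced horoboundary: the image of the horoboundary in `Cʳ(X)`. -/
def reducedHoroboundary : Set (CRed X) := toCRed X '' horoboundary X

end MetricSpaces

/-! ### The action induced by an isometric action -/

section Action

variable (G : Type*) [Group G] (X : Type*) [MetricSpace X] [MulAction G X] [IsIsometricSMul G X]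

/-- The action of `G` on `C(X)`, `(g f)(x) = f (g⁻¹ x)`. -/
def translate : Representation ℝ G C(X, ℝ) where
  toFun g :=
    { toFun := fun f => ⟨fun x => f (g⁻¹ • x), f.continuous.comp (continuous_const_smul g⁻¹)⟩
      map_add' := fun _ _ => rfl
      map_smul' := fun _ _ => rfl }
  map_one' := by
    ext f x
    simp
  map_mul' g h := by
    ext f x
    simp [mul_smul]

theorem bounded_le_comap_translate (g : G) :
    bounded X ≤ (bounded X).comap (translate G X g) := by
  rintro f ⟨C, hC⟩
  exact ⟨C, fun x => hC (g⁻¹ • x)⟩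

/-- The induced action of `G` on `Cʳ(X)`, `g [f] = [g f]`. -/
def reducedAction : Representation ℝ G (CRed X) where
  toFun g := (bounded X).mapQ (bounded X) (translate G X g) (bounded_le_comap_translate G X g)
  map_one' := by
    apply Submodule.linearMap_qext
    ext f
    simp
  map_mul' g h := by
    apply Submodule.linearMap_qext
    ext f
    simp

end Action

/-! ### Word metrics -/

section WordMetric

variable {G : Type*} [Group G]

/-- The word norm: the least length of a word in the letters `S ∪ S⁻¹` that represents `g`. -/
def wordNorm (S : Set G) (g : G) : ℕ :=
  sInf {n | ∃ l : List G, (∀ s ∈ l, s ∈ S ∨ s⁻¹ ∈ S) ∧ l.prod = g ∧ l.length = n}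

theorem wordNorm_le {S : Set G} (l : List G) (hl : ∀ s ∈ l, s ∈ S ∨ s⁻¹ ∈ S) :
    wordNorm S l.prod ≤ l.length :=
  Nat.sInf_le ⟨l, hl, rfl, rfl⟩

theorem exists_word {S : Set G} (hS : Subgroup.closure S = ⊤) (g : G) :
    ∃ l : List G, (∀ s ∈ l, s ∈ S ∨ s⁻¹ ∈ S) ∧ l.prod = g ∧ l.length = wordNorm S g := by
  have hg : g ∈ Subgroup.closure S := hS ▸ Subgroup.mem_top g
  rw [← Subgroup.mem_toSubmonoid, Subgroup.closure_toSubmonoid] at hg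
  obtain ⟨l, hl, hlg⟩ := Submonoid.exists_list_of_mem_closure hg
  exact Nat.sInf_mem
    (s := {n | ∃ l : List G, (∀ s ∈ l, s ∈ S ∨ s⁻¹ ∈ S) ∧ l.prod = g ∧ l.length = n})
    ⟨l.length, l, hl, hlg, rfl⟩

theorem wordNorm_one (S : Set G) : wordNorm S 1 = 0 :=
  Nat.le_zero.mp (wordNorm_le (S := S) [] (by simp))

theorem wordNorm_mul_le {S : Set G} (hS : Subgroup.closure S = ⊤) (g h : G) :
    wordNorm S (g * h) ≤ wordNorm S g + wordNorm S h := by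
  obtain ⟨l, hl, rfl, hl'⟩ := exists_word hS g
  obtain ⟨m, hm, rfl, hm'⟩ := exists_word hS h
  rw [← hl', ← hm', ← List.prod_append, ← List.length_append]
  refine wordNorm_le _ fun s hs => ?_
  rcases List.mem_append.mp hs with h | h
  exacts [hl s h, hm s h]

theorem wordNorm_inv_le {S : Set G} (hS : Subgroup.closure S = ⊤) (g : G) :
    wordNorm S g⁻¹ ≤ wordNorm S g := by
  obtain ⟨l, hl, rfl, hl'⟩ := exists_word hS g
  rw [← hl', List.prod_inv_reverse]
  refine (wordNorm_le _ fun s hs => ?_).trans (by simp)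
  simp only [List.mem_reverse, List.mem_map] at hs
  obtain ⟨t, ht, rfl⟩ := hs
  simpa using (hl t ht).symm

theorem wordNorm_inv {S : Set G} (hS : Subgroup.closure S = ⊤) (g : G) :
    wordNorm S g⁻¹ = wordNorm S g :=
  le_antisymm (wordNorm_inv_le hS g) (by simpa using wordNorm_inv_le hS g⁻¹)

theorem eq_one_of_wordNorm {S : Set G} (hS : Subgroup.closure S = ⊤) {g : G}
    (h : wordNorm S g = 0) : g = 1 := by
  obtain ⟨l, -, rfl, hl'⟩ := exists_word hS g
  rw [h, List.length_eq_zero_iff] at hl'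
  simp [hl']

/-- The group `G`, regarded as a metric space with the word metric of the generating set `S`. -/
def WordMetric (S : Set G) (_hS : Subgroup.closure S = ⊤) : Type _ := G

variable (S : Set G) (hS : Subgroup.closure S = ⊤)

/-- The word metric `d(x, y) = |x⁻¹ y|`. -/
instance : MetricSpace (WordMetric S hS) where
  dist := fun x y : G => (wordNorm S (x⁻¹ * y) : ℝ)
  dist_self := fun x : G => by
    change (wordNorm S (x⁻¹ * x) : ℝ) = 0
    rw [inv_mul_cancel, wordNorm_one, Nat.cast_zero]
  dist_comm := fun x y : G => by
    change (wordNorm S (x⁻¹ * y) : ℝ) = wordNorm S (y⁻¹ * x)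
    rw [← wordNorm_inv hS, mul_inv_rev, inv_inv]
  dist_triangle := fun x y z : G => by
    change (wordNorm S (x⁻¹ * z) : ℝ) ≤ wordNorm S (x⁻¹ * y) + wordNorm S (y⁻¹ * z)
    have h : x⁻¹ * z = (x⁻¹ * y) * (y⁻¹ * z) := by group
    rw [h]
    exact_mod_cast wordNorm_mul_le hS _ _
  eq_of_dist_eq_zero := fun {x y : G} h => by
    change (wordNorm S (x⁻¹ * y) : ℝ) = 0 at h
    exact (inv_mul_eq_one (G := G)).mp (eq_one_of_wordNorm hS (by exact_mod_cast h))

/-- `G` acts on itself by left multiplication. -/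
instance : MulAction G (WordMetric S hS) := inferInstanceAs (MulAction G G)

instance : IsIsometricSMul G (WordMetric S hS) where
  isometry_smul g := Isometry.of_dist_eq fun x y : G => by
    change (wordNorm S ((g * x)⁻¹ * (g * y)) : ℝ) = wordNorm S (x⁻¹ * y)
    congr 2
    group

end WordMetric

end Horo

end

noncomputable section

namespace Horo

section Subadditive

variable {G : Type*} [CommGroup G]

theorem subadditive_neg_le {q : G → ℝ} (hq : ∀ x y, q (x * y) ≤ q x + q y) (x : G) :
    -q x⁻¹ ≤ q x := by
  have h₁ := hq 1 1
  have h₂ := hq x x⁻¹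
  rw [mul_one] at h₁
  rw [mul_inv_cancel] at h₂
  linarith

/-- Below every subadditive function there is a minimal one. -/
theorem exists_minimal_subadditive {p : G → ℝ} (hp : ∀ x y, p (x * y) ≤ p x + p y) :
    ∃ q : G → ℝ, (∀ x y, q (x * y) ≤ q x + q y) ∧ q ≤ p ∧
      ∀ r : G → ℝ, (∀ x y, r (x * y) ≤ r x + r y) → r ≤ q → q ≤ r := by
  let Q : Set (G → ℝ) := {q | (∀ x y, q (x * y) ≤ q x + q y) ∧ q ≤ p}
  suffices h : ∀ c ⊆ Q, IsChain (· ≤ ·) c → ∃ r ∈ Q, ∀ q ∈ c, r ≤ q by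
    obtain ⟨m, hm, hmax⟩ := zorn_le₀ (α := (G → ℝ)ᵒᵈ) Q fun c hc hchain => h c hc hchain.symm
    exact ⟨m, hm.1, hm.2, fun r hr hrm => hmax (y := r) ⟨hr, le_trans hrm hm.2⟩ hrm⟩
  intro c hc hchain
  rcases c.eq_empty_or_nonempty with rfl | hne
  · exact ⟨p, ⟨hp, le_rfl⟩, by simp⟩
  have : Nonempty c := hne.to_subtype
  have hbdd (x : G) : BddBelow (Set.range fun q : c => (q : G → ℝ) x) := by
    refine ⟨-p x⁻¹, ?_⟩
    rintro _ ⟨q, rfl⟩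
    exact (neg_le_neg ((hc q.2).2 x⁻¹)).trans (subadditive_neg_le (hc q.2).1 x)
  have hle (q : c) (x : G) : ⨅ q : c, (q : G → ℝ) x ≤ (q : G → ℝ) x := ciInf_le (hbdd x) q
  refine ⟨fun x => ⨅ q : c, (q : G → ℝ) x, ⟨fun x y => ?_, fun x => ?_⟩, fun q hq x => hle ⟨q, hq⟩ x⟩
  · refine le_ciInf_add_ciInf fun q r => ?_
    rcases hchain.total r.2 q.2 with h | h
    · exact (hle r _).trans (((hc r.2).1 x y).trans (add_le_add_left (h x) _))
    · exact (hle q _).trans (((hc q.2).1 x y).trans (add_le_add_right (h y) _))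
  · obtain ⟨q⟩ := this
    exact (hle q x).trans ((hc q.2).2 x)

/-- A Hahn–Banach theorem for abelian groups: a subadditive function dominates an additive one. -/
theorem exists_additive_le {p : G → ℝ} (hp : ∀ x y, p (x * y) ≤ p x + p y) :
    ∃ f : G → ℝ, (∀ x y, f (x * y) = f x + f y) ∧ ∀ x, f x ≤ p x := by
  obtain ⟨q, hq, hqp, hmin⟩ := exists_minimal_subadditive hp
  have hpow (n : ℕ) (x : G) : q (x ^ (n + 1)) ≤ (n + 1) * q x := by
    induction n with
    | zero => simp
    | succ n ih =>
      rw [pow_succ]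
      push_cast
      linarith [hq (x ^ (n + 1)) x]
  have hhom (n : ℕ) (x : G) : (n + 1) * q x ≤ q (x ^ (n + 1)) := by
    have hn : (0 : ℝ) < n + 1 := by positivity
    have h := hmin (fun x => q (x ^ (n + 1)) / (n + 1)) (fun x y => by
      rw [mul_pow, ← add_div]
      gcongr
      exact hq _ _) (fun x => by
      rw [div_le_iff₀ hn, mul_comm]
      exact hpow n x) x
    rwa [le_div_iff₀ hn, mul_comm] at h
  have hone : q 1 = 0 := by
    have h₁ := hhom 1 1
    have h₂ := hq 1 1
    simp only [one_pow, mul_one] at h₁ h₂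
    push_cast at h₁
    linarith
  have hpow_ge (n : ℕ) (y : G) : n * q y ≤ q (y ^ n) := by
    cases n with
    | zero => simp [hone]
    | succ n => exact_mod_cast hhom n y
  refine ⟨q, fun x y => le_antisymm (hq x y) ?_, hqp⟩
  have hbdd (x : G) : BddBelow (Set.range fun n : ℕ => q (x * y ^ n) - n * q y) := by
    refine ⟨-q x⁻¹, ?_⟩
    rintro _ ⟨n, rfl⟩
    have h := hq x⁻¹ (x * y ^ n)
    rw [inv_mul_cancel_left] at h
    have := hpow_ge n y
    simp only
    linarith
  have h := hmin (fun x => ⨅ n : ℕ, (q (x * y ^ n) - n * q y)) (fun x z => by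
    refine le_ciInf_add_ciInf fun n m => (ciInf_le (hbdd _) (n + m)).trans ?_
    have h := hq (x * y ^ n) (z * y ^ m)
    rw [mul_mul_mul_comm, ← pow_add] at h
    push_cast
    linarith) (fun x => (ciInf_le (hbdd x) 0).trans (by simp)) x
  have h' := h.trans (ciInf_le (hbdd x) 1)
  simp only [pow_one, Nat.cast_one, one_mul] at h'
  linarith

end Subadditive

section Faces

variable {G : Type*} [CommGroup G] {S : Set G}

theorem exists_multiset (hS : Subgroup.closure S = ⊤) (g : G) :
    ∃ m : Multiset G, (∀ s ∈ m, s ∈ S ∨ s⁻¹ ∈ S) ∧ m.prod = g ∧ m.card = wordNorm S g := by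
  obtain ⟨l, hl, hlg, hlen⟩ := exists_word hS g
  exact ⟨l, by simpa using hl, by simpa using hlg, by simpa using hlen⟩

theorem wordNorm_multiset_le {m : Multiset G} (hm : ∀ s ∈ m, s ∈ S ∨ s⁻¹ ∈ S) :
    wordNorm S m.prod ≤ m.card := by
  induction m using Quotient.inductionOn with
  | h l => simpa using wordNorm_le l (by simpa using hm)

variable (S) in
/-- A set of letters is a face if every word in these letters is geodesic. -/
def IsFace (A : Set G) : Prop :=
  ∀ m : Multiset G, (∀ s ∈ m, s ∈ A) → wordNorm S m.prod = m.card

theorem IsFace.exists_additive (hS : Subgroup.closure S = ⊤) {A : Set G} (hA : IsFace S A) :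
    ∃ f : G → ℝ, (∀ x y, f (x * y) = f x + f y) ∧ (∀ x, f x ≤ wordNorm S x) ∧
      ∀ s ∈ A, 1 ≤ f s := by
  let M := {m : Multiset G // ∀ s ∈ m, s ∈ A}
  have : Nonempty M := ⟨⟨0, by simp⟩⟩
  let b (x : G) : ℝ := ⨅ m : M, ((wordNorm S (x * m.1.prod) : ℝ) - m.1.card)
  have hbdd (x : G) :
      BddBelow (Set.range fun m : M => (wordNorm S (x * m.1.prod) : ℝ) - m.1.card) := by
    refine ⟨-wordNorm S x⁻¹, ?_⟩
    rintro _ ⟨m, rfl⟩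
    have h := wordNorm_mul_le hS x⁻¹ (x * m.1.prod)
    rw [inv_mul_cancel_left, hA m.1 m.2] at h
    have h' : (m.1.card : ℝ) ≤ wordNorm S x⁻¹ + wordNorm S (x * m.1.prod) := by exact_mod_cast h
    simp only
    linarith
  have hb (x : G) (m : M) : b x ≤ (wordNorm S (x * m.1.prod) : ℝ) - m.1.card := ciInf_le (hbdd x) m
  obtain ⟨f, hf, hfb⟩ := exists_additive_le (p := b) fun x y => by
    refine le_ciInf_add_ciInf fun m n => ?_
    refine (hb _ ⟨m.1 + n.1, fun s hs => (Multiset.mem_add.mp hs).elim (m.2 s) (n.2 s)⟩).trans ?_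
    have h := wordNorm_mul_le hS (x * m.1.prod) (y * n.1.prod)
    rw [mul_mul_mul_comm] at h
    have h' : (wordNorm S (x * y * (m.1.prod * n.1.prod)) : ℝ) ≤
      wordNorm S (x * m.1.prod) + wordNorm S (y * n.1.prod) := by exact_mod_cast h
    simp only [Multiset.prod_add, Multiset.card_add]
    push_cast
    linarith
  refine ⟨f, hf, fun x => (hfb x).trans ((hb x ⟨0, by simp⟩).trans (by simp)), fun s hs => ?_⟩
  have h₁ := (hfb s⁻¹).trans (hb s⁻¹ ⟨{s}, by simpa using hs⟩)
  have h₂ := hf s s⁻¹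
  have h₃ := hf 1 1
  simp only [Multiset.prod_singleton, inv_mul_cancel, wordNorm_one, Multiset.card_singleton] at h₁
  rw [mul_inv_cancel] at h₂
  rw [mul_one] at h₃
  push_cast at h₁
  linarith

open Classical in
/-- The letters that occur often enough in a geodesic word form a face. -/
theorem exists_isFace_filter (T : Finset G) :
    ∃ K : ℕ, ∀ m : Multiset G, (∀ n ≤ m, wordNorm S n.prod = n.card) →
      IsFace S (T.filter fun s => K < m.count s : Set G) := by
  have h (A : Finset G) : ∃ K : ℕ, ¬ IsFace S (A : Set G) →
      ∃ v : Multiset G, (∀ s ∈ v, s ∈ A) ∧ wordNorm S v.prod ≠ v.card ∧ v.card ≤ K := by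
    by_cases hA : IsFace S (A : Set G)
    · exact ⟨0, fun h => absurd hA h⟩
    · have hA' := hA
      simp only [IsFace, not_forall] at hA'
      obtain ⟨v, hv, hne⟩ := hA'
      exact ⟨v.card, fun _ => ⟨v, by simpa using hv, hne, le_rfl⟩⟩
  choose k hk using h
  refine ⟨T.powerset.sup k, fun m hm => ?_⟩
  by_contra hface
  set K := T.powerset.sup k
  obtain ⟨v, hv, hne, hcard⟩ := hk (T.filter fun s => K < m.count s) (by simpa using hface)
  refine hne (hm v (Multiset.le_iff_count.mpr fun s => ?_))
  by_cases hs : s ∈ v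
  · have hK : k (T.filter fun s => K < m.count s) ≤ K :=
      Finset.le_sup (f := k) (Finset.mem_powerset.mpr (Finset.filter_subset _ _))
    have := (Finset.mem_filter.mp (hv s hs)).2
    have := Multiset.count_le_card s v
    omega
  · simp [Multiset.count_eq_zero_of_notMem hs]

theorem wordNorm_prod_of_le (hS : Subgroup.closure S = ⊤) {m n : Multiset G}
    (hm : ∀ s ∈ m, s ∈ S ∨ s⁻¹ ∈ S) (hgeod : wordNorm S m.prod = m.card) (hn : n ≤ m) :
    wordNorm S n.prod = n.card := by
  obtain ⟨r, rfl⟩ := Multiset.le_iff_exists_add.mp hn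
  have h₁ := wordNorm_multiset_le fun s hs => hm s (Multiset.mem_add.mpr (Or.inl hs))
  have h₂ := wordNorm_multiset_le fun s hs => hm s (Multiset.mem_add.mpr (Or.inr hs))
  have h₃ := wordNorm_mul_le hS n.prod r.prod
  rw [Multiset.prod_add, Multiset.card_add] at hgeod
  omega

theorem card_le_additive {f : G → ℝ} (hf : ∀ x y, f (x * y) = f x + f y) {m : Multiset G}
    (hm : ∀ s ∈ m, 1 ≤ f s) : (m.card : ℝ) ≤ f m.prod := by
  induction m using Multiset.induction_on with
  | empty =>
    have h := hf 1 1
    rw [mul_one] at h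
    simp only [Multiset.card_zero, Nat.cast_zero, Multiset.prod_zero]
    linarith
  | cons s m ih =>
    have h₁ := ih fun t ht => hm t (Multiset.mem_cons_of_mem ht)
    have h₂ := hm s (Multiset.mem_cons_self s m)
    rw [Multiset.prod_cons, hf, Multiset.card_cons]
    push_cast
    linarith

/-- Up to a bounded error, the word norm is the maximum of finitely many additive functions. -/
theorem exists_finite_additive (hfin : S.Finite) (hS : Subgroup.closure S = ⊤) :
    ∃ F : Set (G → ℝ), F.Finite ∧
      (∀ f ∈ F, (∀ x y, f (x * y) = f x + f y) ∧ ∀ x, f x ≤ wordNorm S x) ∧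
      ∃ C : ℝ, ∀ x, ∃ f ∈ F, wordNorm S x ≤ f x + C := by
  classical
  have hTfin : {s | s ∈ S ∨ s⁻¹ ∈ S}.Finite := hfin.union hfin.inv
  set T : Finset G := hTfin.toFinset with hT
  obtain ⟨K, hK⟩ := exists_isFace_filter (S := S) T
  choose f hadd hle hone using fun A : {A : Finset G // A ∈ T.powerset ∧ IsFace S (A : Set G)} =>
    A.2.2.exists_additive hS
  have : Finite {A : Finset G // A ∈ T.powerset ∧ IsFace S (A : Set G)} :=
    (T.powerset.finite_toSet.subset fun A hA => hA.1).to_subtype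
  refine ⟨Set.range f, Set.finite_range f, ?_, 2 * (T.card * K : ℕ), fun x => ?_⟩
  · rintro _ ⟨A, rfl⟩
    exact ⟨hadd A, hle A⟩
  obtain ⟨m, hm, rfl, hgeod⟩ := exists_multiset hS x
  have hface := hK m fun n hn => wordNorm_prod_of_le hS hm hgeod.symm hn
  have hface' : IsFace S (T.filter fun s => K < m.count s : Finset G) := by simpa using hface
  set A : {A : Finset G // A ∈ T.powerset ∧ IsFace S (A : Set G)} :=
    ⟨T.filter fun s => K < m.count s, Finset.mem_powerset.mpr (Finset.filter_subset _ _), hface'⟩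
    with hA
  refine ⟨f A, ⟨A, rfl⟩, ?_⟩
  set n := m.filter fun s => K < m.count s with hn
  set c := m.filter fun s => ¬ K < m.count s with hc
  have hmem {s : G} (hs : s ∈ m) : s ∈ T := by simpa [hT] using hm s hs
  have hsum : n + c = m := Multiset.filter_add_not _ m
  have hcard : c.card ≤ T.card * K := by
    have hcT : c.toFinset ⊆ T := fun s hs =>
      hmem (Multiset.mem_of_mem_filter (Multiset.mem_toFinset.mp hs))
    rw [← Multiset.toFinset_sum_count_eq c]
    refine (Finset.sum_le_card_nsmul _ _ K fun s hs => ?_).trans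
      (Nat.mul_le_mul_right K (Finset.card_le_card hcT))
    have h := Multiset.of_mem_filter (Multiset.mem_toFinset.mp hs)
    exact (Multiset.count_le_of_le s (Multiset.filter_le _ m)).trans (not_lt.mp h)
  have hnf : (n.card : ℝ) ≤ f A n.prod := by
    refine card_le_additive (hadd A) fun s hs => hone A s ?_
    rw [hn, Multiset.mem_filter] at hs
    simpa [hA] using ⟨hmem hs.1, hs.2⟩
  have hcf : -(c.card : ℝ) ≤ f A c.prod := by
    have h₁ := subadditive_neg_le (fun x y => (hadd A x y).le) c.prod
    have h₂ := hle A c.prod⁻¹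
    rw [wordNorm_inv hS] at h₂
    have h₃ : (wordNorm S c.prod : ℝ) ≤ c.card := by
      exact_mod_cast wordNorm_multiset_le fun s hs => hm s (Multiset.mem_of_mem_filter hs)
    linarith
  have hcard' : (c.card : ℝ) ≤ (T.card * K : ℕ) := by exact_mod_cast hcard
  have hmc : (m.card : ℝ) = n.card + c.card := by
    rw [← hsum, Multiset.card_add, Nat.cast_add]
  rw [← hgeod, hmc, ← hsum, Multiset.prod_add, hadd A]
  linarith

end Faces

section Horofunctions

open Filter Topology

/-- The functional `[ψ] ↦ ψ x - ψ y` on `C⁰(X)`. -/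
def evalSub {X : Type*} [MetricSpace X] (x y : X) : CZero X →ₗ[ℝ] ℝ :=
  (constants X).liftQ
    { toFun := fun ψ => ψ x - ψ y
      map_add' := fun ψ χ => by simp only [ContinuousMap.add_apply]; ring
      map_smul' := fun r ψ => by
        simp only [ContinuousMap.smul_apply, smul_eq_mul, RingHom.id_apply]; ring } <| by
    rintro _ ⟨c, rfl⟩
    simp

theorem continuous_evalSub {X : Type*} [MetricSpace X] (x y : X) : Continuous (evalSub x y) :=
  continuous_quot_lift _ ((continuous_eval_const x).sub (continuous_eval_const y))

variable {G : Type*} [CommGroup G] {S : Set G}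

/-- A pointwise limit of the functions `y ↦ |x⁻¹ y| - |x⁻¹|` is, up to a bounded error, the
maximum of some of the additive functions that approximate the word norm. -/
theorem exists_subset_of_tendsto (hS : Subgroup.closure S = ⊤) {F : Set (G → ℝ)} (hF : F.Finite)
    (hadd : ∀ f ∈ F, (∀ x y, f (x * y) = f x + f y) ∧ ∀ x, f x ≤ wordNorm S x) {C : ℝ}
    (hC : ∀ x, ∃ f ∈ F, wordNorm S x ≤ f x + C) (U : Ultrafilter G) {h : G → ℝ}
    (hU : ∀ y, Tendsto (fun x => (wordNorm S (x⁻¹ * y) : ℝ) - wordNorm S x⁻¹) U (𝓝 (h y))) :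
    ∃ J ⊆ F, (∀ y, ∃ f ∈ J, h y ≤ f y + C) ∧ ∃ R : ℝ, ∀ f ∈ J, ∀ y, f y - R ≤ h y := by
  let J : Set (G → ℝ) :=
    {f | f ∈ F ∧ ∃ R : ℝ, ∀ᶠ x in U, (wordNorm S x⁻¹ : ℝ) - R ≤ f x⁻¹}
  refine ⟨J, fun f hf => hf.1, fun y => ?_, ?_⟩
  · obtain ⟨f, hf, hev⟩ : ∃ f ∈ F, ∀ᶠ x in U, (wordNorm S (x⁻¹ * y) : ℝ) ≤ f (x⁻¹ * y) + C := by
      refine (Ultrafilter.eventually_exists_mem_iff hF).mp (Eventually.of_forall fun x => ?_)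
      exact hC _
    refine ⟨f, ⟨hf, wordNorm S y⁻¹ + f y + C, ?_⟩, ?_⟩
    · filter_upwards [hev] with x hx
      have h₁ := wordNorm_mul_le hS (x⁻¹ * y) y⁻¹
      rw [mul_inv_cancel_right] at h₁
      have h₂ : (wordNorm S x⁻¹ : ℝ) ≤ wordNorm S (x⁻¹ * y) + wordNorm S y⁻¹ := by
        exact_mod_cast h₁
      rw [(hadd f hf).1] at hx
      linarith
    · refine le_of_tendsto (hU y) ?_
      filter_upwards [hev] with x hx
      rw [(hadd f hf).1] at hx
      linarith [(hadd f hf).2 x⁻¹]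
  · have hJ : J.Finite := hF.subset fun f hf => hf.1
    have hR : ∀ f : G → ℝ, ∃ R : ℝ, f ∈ J → ∀ᶠ x in U, (wordNorm S x⁻¹ : ℝ) - R ≤ f x⁻¹ := by
      intro f
      by_cases hf : f ∈ J
      · obtain ⟨R, hR⟩ := hf.2
        exact ⟨R, fun _ => hR⟩
      · exact ⟨0, fun h => absurd h hf⟩
    choose R hR using hR
    obtain ⟨B, hB⟩ := (hJ.image R).bddAbove
    refine ⟨B, fun f hf y => ge_of_tendsto (hU y) ?_⟩
    filter_upwards [hR f hf] with x hx
    have h₁ := (hadd f hf.1).2 (x⁻¹ * y)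
    rw [(hadd f hf.1).1] at h₁
    linarith [hB ⟨f, hf, rfl⟩]

theorem exists_ultrafilter_of_mem_closure (hS : Subgroup.closure S = ⊤)
    {φ : C(WordMetric S hS, ℝ)}
    (hφ : (constants (WordMetric S hS)).mkQ φ ∈ closure (Set.range (embed (WordMetric S hS)))) :
    ∃ U : Ultrafilter G, ∀ y : G,
      Tendsto (fun x => (wordNorm S (x⁻¹ * y) : ℝ) - wordNorm S x⁻¹) U
        (𝓝 (φ (y : WordMetric S hS) - φ ((1 : G) : WordMetric S hS))) := by
  have hne : (comap (embed (WordMetric S hS)) (𝓝 ((constants _).mkQ φ))).NeBot := by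
    rw [comap_neBot_iff]
    intro t ht
    obtain ⟨_, hxt, x, rfl⟩ := mem_closure_iff_nhds.mp hφ t ht
    exact ⟨x, hxt⟩
  let U := Ultrafilter.of (comap (embed (WordMetric S hS)) (𝓝 ((constants _).mkQ φ)))
  refine ⟨U, fun y => ?_⟩
  have hlim : Tendsto (embed (WordMetric S hS)) U (𝓝 ((constants _).mkQ φ)) :=
    tendsto_comap.mono_left (Ultrafilter.of_le _)
  have h := ((continuous_evalSub (X := WordMetric S hS) y (1 : G)).tendsto _).comp hlim
  refine h.congr fun x => ?_
  change (wordNorm S ((x : G)⁻¹ * y) : ℝ) - wordNorm S ((x : G)⁻¹ * 1) = _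
  rw [mul_one]

theorem reducedAction_eq_self (hS : Subgroup.closure S = ⊤) (g : G)
    {ξ : CRed (WordMetric S hS)} (hξ : ξ ∈ reducedHoroboundary (WordMetric S hS)) :
    reducedAction G (WordMetric S hS) g ξ = ξ := by
  obtain ⟨η, hη, rfl⟩ := hξ
  obtain ⟨φ, rfl⟩ := Submodule.mkQ_surjective _ η
  obtain ⟨U, hU⟩ := exists_ultrafilter_of_mem_closure hS hη.1
  refine (Submodule.Quotient.eq (bounded (WordMetric S hS))).mpr
    ⟨wordNorm S g, fun y : G => ?_⟩
  have hlim := (hU (g⁻¹ * y)).sub (hU y)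
  simp only [sub_sub_sub_cancel_right] at hlim
  refine le_of_tendsto hlim.abs (Eventually.of_forall fun x => ?_)
  have h₁ := wordNorm_mul_le hS g⁻¹ (x⁻¹ * y)
  have h₂ := wordNorm_mul_le hS g (x⁻¹ * (g⁻¹ * y))
  rw [mul_left_comm, wordNorm_inv hS] at h₁
  rw [mul_left_comm, mul_inv_cancel_left] at h₂
  have h₁' : (wordNorm S (x⁻¹ * (g⁻¹ * y)) : ℝ) ≤ wordNorm S g + wordNorm S (x⁻¹ * y) := by
    exact_mod_cast h₁
  have h₂' : (wordNorm S (x⁻¹ * y) : ℝ) ≤ wordNorm S g + wordNorm S (x⁻¹ * (g⁻¹ * y)) := by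
    exact_mod_cast h₂
  rw [abs_le]
  constructor <;> linarith

theorem finite_reducedHoroboundary (hfin : S.Finite) (hS : Subgroup.closure S = ⊤) :
    (reducedHoroboundary (WordMetric S hS)).Finite := by
  obtain ⟨F, hF, hadd, C, hC⟩ := exists_finite_additive hfin hS
  have key : ∀ ξ ∈ reducedHoroboundary (WordMetric S hS), ∃ J ⊆ F,
      ∃ φ : C(WordMetric S hS, ℝ), (bounded (WordMetric S hS)).mkQ φ = ξ ∧ ∃ R : ℝ, ∀ y,
        (∃ f ∈ J, φ y ≤ f y + R) ∧ ∀ f ∈ J, f y ≤ φ y + R := by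
    rintro _ ⟨η, hη, rfl⟩
    obtain ⟨φ, rfl⟩ := Submodule.mkQ_surjective _ η
    obtain ⟨U, hU⟩ := exists_ultrafilter_of_mem_closure hS hη.1
    obtain ⟨J, hJF, hupper, R, hlower⟩ := exists_subset_of_tendsto hS hF hadd hC U hU
    set a := φ ((1 : G) : WordMetric S hS)
    refine ⟨J, hJF, φ, rfl, max (C + a) (R - a), fun y => ⟨?_, fun f hf => ?_⟩⟩
    · obtain ⟨f, hf, h⟩ := hupper y
      exact ⟨f, hf, by linarith [le_max_left (C + a) (R - a)]⟩
    · linarith [hlower f hf y, le_max_right (C + a) (R - a)]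
  choose! J hJF φ hφ R hR using key
  have hbound : ∀ ξ ∈ reducedHoroboundary (WordMetric S hS),
      ∀ ζ ∈ reducedHoroboundary (WordMetric S hS), J ξ = J ζ →
        ∀ y, φ ξ y - φ ζ y ≤ R ξ + R ζ := by
    intro ξ hξ ζ hζ hJ y
    obtain ⟨f, hf, h⟩ := (hR ξ hξ y).1
    linarith [(hR ζ hζ y).2 f (hJ ▸ hf)]
  refine Set.Finite.of_finite_image (f := J) (hF.finite_subsets.subset ?_) fun ξ hξ ζ hζ hJ => ?_
  · rintro _ ⟨ξ, hξ, rfl⟩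
    exact hJF ξ hξ
  · rw [← hφ ξ hξ, ← hφ ζ hζ]
    refine (Submodule.Quotient.eq (bounded (WordMetric S hS))).mpr ⟨R ξ + R ζ, fun y => ?_⟩
    have h₁ := hbound ξ hξ ζ hζ hJ y
    have h₂ := hbound ζ hζ ξ hξ hJ.symm y
    rw [ContinuousMap.sub_apply, abs_le]
    constructor <;> linarith

end Horofunctions

end Horo

end

theorem theoremA {G : Type*} [CommGroup G] (S : Set G) (hfin : S.Finite)
    (hS : Subgroup.closure S = ⊤) :
    (Horo.reducedHoroboundary (Horo.WordMetric S hS)).Finite ∧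
      ∀ g : G, ∀ ξ ∈ Horo.reducedHoroboundary (Horo.WordMetric S hS),
        Horo.reducedAction G (Horo.WordMetric S hS) g ξ = ξ :=
  ⟨Horo.finite_reducedHoroboundary hfin hS, fun g _ hξ => Horo.reducedAction_eq_self hS g hξ⟩
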